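/- Let $\Sigma$ be a totally ordered alphabet and order strings over $\Sigma$ lexicographically (a proper prefix being smaller). For a string $w$, $\mathsf{BWT}(w)$ is the concatenation of the last symbols of all $|w|$ cyclic rotations of $w$, listed in lexicographic order. A Lyndon word is a nonempty string that is lexicographically smaller than all of its proper nonempty suffixes, and the Lyndon factorization of $w$ is the unique way of writing $w$ as a concatenation of a lexicographically non-increasing sequence of Lyndon words. The bijective transform $\mathsf{BBWT}(w)$ is the concatenation of the last symbols of all cyclic rotations of all factors (counted with multiplicity) in the Lyndon factorization of $w$, listed in $\omega$-order, where $x\prec_\omega y$ if and only if $x^\infty\prec y^\infty$. Let $r(w)$ and $r_B(w)$ be the numbers of maximal same-character runs in $\mathsf{BWT}(w)$ and $\mathsf{BBWT}(w)$, respectively. For letters $\mathtt a\prec\mathtt b$ of $\Sigma$ define the Fibonacci words by $F_0=\mathtt b$, $F_1=\mathtt a$, and $F_k=F_{k-1}F_{k-2}$ for $k\ge 2$. Theorem. There is an absolute constant $c>0$ such that, for every totally ordered alphabet and all letters $\mathtt a\prec\mathtt b$ in it, the lengths $|F_k|$ tend to infinity with $k$ and, for every odd $k\ge 3$, $$ r(F_k)=2\qquad\text{and}\qquad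 r_B(F_k)\ \ge\ c\,\log |F_k| .$$ In particular, there is an infinite family of strings with $r=2$ and $r_B=\Omega(\log n)$, where $n$ is the length of the string. -/

import Mathlib

/-! Strings over a totally ordered alphabet `α` are lists; the order on `List α` is the
lexicographic order, in which a proper prefix is smaller. -/

namespace BijectiveBWT

section Definitions

variable {α : Type*} [LinearOrder α]

/-- A Lyndon word: a nonempty string that is lexicographically smaller than all of its proper
(nonempty) suffixes. -/
def IsLyndon (w : List α) : Prop :=
  w ≠ [] ∧ ∀ u v : List α, u ≠ [] → v ≠ [] → w = u ++ v → w < v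

/-- `fs` is a partition of `w` into a lexicographically non-increasing sequence of Lyndon words
(repeated factors are listed with their multiplicity). -/
def IsLyndonFactorization (fs : List (List α)) (w : List α) : Prop :=
  fs.flatten = w ∧ (∀ f ∈ fs, IsLyndon f) ∧ fs.Pairwise (fun f g => g ≤ f)

/-! Existence and uniqueness of the Lyndon factorization. -/

theorem append_lt_append_of_lt_of_not_prefix {a b : List α} (h : a < b) (hp : ¬ a <+: b)
    (x y : List α) : a ++ x < b ++ y := by
  induction a generalizing b with
  | nil => exact absurd List.nil_prefix hp
  | cons c a ih =>
    cases b with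
    | nil => simp at h
    | cons d b =>
      rw [List.cons_lt_cons_iff] at h
      rw [List.cons_append, List.cons_append, List.cons_lt_cons_iff]
      rcases h with h | ⟨rfl, h⟩
      · exact Or.inl h
      · refine Or.inr ⟨rfl, ih h ?_⟩
        intro hp'
        exact hp (by simpa using hp')

theorem append_lt_append_left {a b : List α} (c : List α) (h : a < b) : c ++ a < c ++ b := by
  induction c with
  | nil => simpa using h
  | cons d c ih =>
    rw [List.cons_append, List.cons_append, List.cons_lt_cons_iff]
    exact Or.inr ⟨rfl, ih⟩

theorem le_append (a b : List α) : a ≤ a ++ b := by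
  rcases eq_or_ne b [] with rfl | hb
  · simp
  · obtain ⟨c, b, rfl⟩ := List.exists_cons_of_ne_nil hb
    simpa using (append_lt_append_left a (List.nil_lt_cons c b)).le

theorem IsLyndon.singleton (c : α) : IsLyndon [c] := by
  refine ⟨by simp, fun u v hu hv h => ?_⟩
  have h1 := congrArg List.length h
  have h2 := List.length_pos_iff.mpr hu
  have h3 := List.length_pos_iff.mpr hv
  simp at h1
  omega

theorem IsLyndon.append {f g : List α} (hf : IsLyndon f) (hg : IsLyndon g) (h : f < g) :
    IsLyndon (f ++ g) := by
  have key : f ++ g < g := by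
    by_cases hp : f <+: g
    · obtain ⟨t, rfl⟩ := hp
      have ht : t ≠ [] := by
        rintro rfl
        simp at h
      exact append_lt_append_left f (hg.2 f t hf.1 ht rfl)
    · simpa using append_lt_append_of_lt_of_not_prefix h hp g []
  refine ⟨by simp [hf.1], fun u v hu hv huv => ?_⟩
  rcases List.append_eq_append_iff.mp huv with ⟨s, hs, ht⟩ | ⟨s, hs, ht⟩
  · rcases eq_or_ne s [] with rfl | hne
    · simp only [List.nil_append] at ht
      exact ht ▸ key
    · exact key.trans (hg.2 s v hne hv ht)
  · rcases eq_or_ne s [] with rfl | hne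
    · simp only [List.nil_append] at ht
      exact ht ▸ key
    · rw [ht]
      refine append_lt_append_of_lt_of_not_prefix (hf.2 u s hu hne hs) ?_ g g
      intro hp
      have h1 := hp.length_le
      have h2 := List.length_pos_iff.mpr hu
      rw [hs, List.length_append] at h1
      omega

theorem exists_isLyndonFactorization_append {f : List α} (hf : IsLyndon f)
    (gs : List (List α)) (w : List α) (hg : IsLyndonFactorization gs w) :
    ∃ fs, IsLyndonFactorization fs (f ++ w) := by
  induction gs generalizing f w with
  | nil =>
    obtain ⟨rfl, -, -⟩ := hg
    exact ⟨[f], by simp, by simpa using hf, by simp⟩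
  | cons g gs ih =>
    obtain ⟨rfl, hl, hp⟩ := hg
    have hp' := List.pairwise_cons.mp hp
    have hg : IsLyndon g := hl g (by simp)
    rcases lt_or_ge f g with hlt | hge
    · obtain ⟨fs, hfs⟩ := ih (hf.append hg hlt) gs.flatten
        ⟨rfl, fun x hx => hl x (List.mem_cons_of_mem _ hx), hp'.2⟩
      exact ⟨fs, by simpa using hfs⟩
    · refine ⟨f :: g :: gs, by simp, ?_, ?_⟩
      · intro x hx
        rcases List.mem_cons.mp hx with rfl | hx
        · exact hf
        · exact hl x hx
      · refine List.pairwise_cons.mpr ⟨fun x hx => ?_, hp⟩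
        rcases List.mem_cons.mp hx with rfl | hx
        · exact hge
        · exact (hp'.1 x hx).trans hge

theorem exists_isLyndonFactorization (w : List α) : ∃ fs, IsLyndonFactorization fs w := by
  induction w with
  | nil => exact ⟨[], by simp [IsLyndonFactorization]⟩
  | cons c w ih =>
    obtain ⟨fs, hfs⟩ := ih
    exact exists_isLyndonFactorization_append (IsLyndon.singleton c) fs w hfs

theorem exists_suffix_le (f : List α) (fs : List (List α)) (hf : ∀ g ∈ fs, g ≤ f)
    (q t : List α) (hq : q ≠ []) (h : fs.flatten = q ++ t) :
    ∃ r p, p ≠ [] ∧ q = r ++ p ∧ p ≤ f := by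
  induction fs generalizing q with
  | nil => simp_all
  | cons g gs ih =>
    rw [List.flatten_cons] at h
    rcases List.append_eq_append_iff.mp h with ⟨s, hs, ht⟩ | ⟨s, hs, ht⟩
    · rcases eq_or_ne s [] with rfl | hne
      · exact ⟨[], q, hq, rfl, by simpa [hs] using hf g (by simp)⟩
      · obtain ⟨r, p, hp, hrp, hle⟩ :=
          ih (fun x hx => hf x (List.mem_cons_of_mem _ hx)) s hne ht
        exact ⟨g ++ r, p, hp, by rw [hs, hrp, List.append_assoc], hle⟩
    · exact ⟨[], q, hq, rfl, (hs ▸ le_append q s).trans (hf g (by simp))⟩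

theorem not_proper_prefix_first {f g s t : List α} {fs : List (List α)} (hf : f ≠ [])
    (hg : IsLyndon g) (hp : ∀ x ∈ fs, x ≤ f) (hs : s ≠ []) (hgs : g = f ++ s)
    (h : fs.flatten = s ++ t) : False := by
  obtain ⟨r, p, hpne, hrp, hle⟩ := exists_suffix_le f fs hp s t hs h
  have h1 : g < p := hg.2 (f ++ r) p (by simp [hf]) hpne (by rw [hgs, hrp, List.append_assoc])
  have h2 : f ≤ g := hgs ▸ le_append f s
  exact absurd (h1.trans_le (hle.trans h2)) (lt_irrefl _)

theorem IsLyndonFactorization.unique {fs gs : List (List α)} {w : List α}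
    (hf : IsLyndonFactorization fs w) (hg : IsLyndonFactorization gs w) : fs = gs := by
  induction fs generalizing gs w with
  | nil =>
    cases gs with
    | nil => rfl
    | cons g gs =>
      have h1 := (hg.2.1 g (by simp)).1
      have h2 := hg.1.trans hf.1.symm
      simp [h1] at h2
  | cons f fs ih =>
    have hfl := hf.2.1 f (by simp)
    have hfp := List.pairwise_cons.mp hf.2.2
    cases gs with
    | nil =>
      have h2 := hf.1.trans hg.1.symm
      simp [hfl.1] at h2
    | cons g gs =>
      have hgl := hg.2.1 g (by simp)
      have hgp := List.pairwise_cons.mp hg.2.2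
      have h : f ++ fs.flatten = g ++ gs.flatten := by
        simpa using hf.1.trans hg.1.symm
      have hfg : f = g := by
        rcases List.append_eq_append_iff.mp h with ⟨s, hs, ht⟩ | ⟨s, hs, ht⟩
        · rcases eq_or_ne s [] with rfl | hne
          · simpa using hs.symm
          · exact (not_proper_prefix_first hfl.1 hgl hfp.1 hne hs ht).elim
        · rcases eq_or_ne s [] with rfl | hne
          · simpa using hs
          · exact (not_proper_prefix_first hgl.1 hfl hgp.1 hne hs ht).elim
      subst hfg
      have h' : fs.flatten = gs.flatten := by simpa using h
      rw [ih ⟨h', fun x hx => hf.2.1 x (List.mem_cons_of_mem _ hx), hfp.2⟩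
        ⟨rfl, fun x hx => hg.2.1 x (List.mem_cons_of_mem _ hx), hgp.2⟩]

theorem existsUnique_isLyndonFactorization (w : List α) :
    ∃! fs, IsLyndonFactorization fs w := by
  obtain ⟨fs, hfs⟩ := exists_isLyndonFactorization w
  exact ⟨fs, hfs, fun _ hgs => hgs.unique hfs⟩

/-- The Lyndon factorization of `w`, as the list of all factors. -/
noncomputable def lyndonFactorization (w : List α) : List (List α) :=
  (existsUnique_isLyndonFactorization w).choose

/-- The list of all `|w|` cyclic rotations of `w`. -/
def rotations (w : List α) : List (List α) :=
  (List.range w.length).map (fun i => w.rotate i)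

/-- The string of the last symbols of a list of (nonempty) strings. -/
def lastSymbols (l : List (List α)) : List α :=
  l.filterMap List.getLast?

/-- The Burrows-Wheeler transform: the last symbols of all cyclic rotations of `w`, in
lexicographic order. -/
def bwt (w : List α) : List α :=
  lastSymbols ((rotations w).mergeSort (fun x y => decide (x ≤ y)))

/-- The infinite string `x x x ⋯` for nonempty `x`, in the lexicographic order on infinite strings.
(The bottom element `⊥` occurs only for the empty `x`.) -/
def infinitePower (x : List α) : Lex (ℕ → WithBot α) :=
  toLex (fun i => (x[i % x.length]?).elim ⊥ (fun c => (c : WithBot α)))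

/-- The non-strict `ω`-order on nonempty strings; on primitive strings, it is a total order. -/
def OmegaLE (x y : List α) : Prop :=
  infinitePower x ≤ infinitePower y

open Classical in
/-- The bijective Burrows-Wheeler transform: the last symbols of all cyclic rotations of all
factors (with multiplicity) in the Lyndon factorization of `w`, in `ω`-order. -/
noncomputable def bbwt (w : List α) : List α :=
  lastSymbols (((lyndonFactorization w).flatMap rotations).mergeSort
    (fun x y => decide (OmegaLE x y)))

/-- The number of maximal same-character runs of a string. -/
def numRuns (x : List α) : ℕ :=
  (x.splitBy (fun c d => decide (c = d))).length

/-- The number `r` of maximal same-character runs in the Burrows-Wheeler transform. -/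
def r (w : List α) : ℕ := numRuns (bwt w)

/-- The number `r_B` of maximal same-character runs in the bijective Burrows-Wheeler transform. -/
noncomputable def rB (w : List α) : ℕ := numRuns (bbwt w)

end Definitions

/-- The Fibonacci words over the letters `a`, `b`: `F₀ = b`, `F₁ = a`, `Fₖ₊₂ = Fₖ₊₁ Fₖ`. -/
def fibWord {α : Type*} (a b : α) : ℕ → List α
  | 0 => [b]
  | 1 => [a]
  | k + 2 => fibWord a b (k + 1) ++ fibWord a b k

end BijectiveBWT

/-!
Let `θ` be the morphism `a ↦ aab`, `b ↦ ab`, which preserves the `ω`-order of strings over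
`a < b`. For a collection `M` of such strings, the rotations of the members of `θ(M)` are the
strings with infinite powers `aab θ(y)^∞` (for the rotations `y` that end with `a`), `ab θ(y)^∞` and
`b θ(y)^∞`, where `y` runs through the rotations of the members of `M`; they are preceded by `b`, by
the last letter of `y` and by `a`, respectively. Hence, if `t` is the transform of `M` (the last
symbols of all rotations in `ω`-order), the transform of `θ(M)` is `b⋯b t a⋯a`, with one `b` for
each `a` in `t` and one `a` for each letter of `t` (`IsTransform.map_fibMorphism`).

Up to conjugation, `θ` maps the Fibonacci word `Fₖ` to `Fₖ₊₂` (`fibMorphism_fibWord`). As the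
transform of a single string is its Burrows-Wheeler transform, and that of `F₁ = a` is `a`, the
transform of a Fibonacci word of odd index has the form `b⋯ba⋯a`.

The Lyndon factors of `F_{2m+1}` are `θ(b), θ²(b), …, θᵐ(b), a`
(`isLyndonFactorization_fibWord`). The collection `b, θ(b), …, θᵐ(b)` consists of `b` and of the
image under `θ` of the collection for `m - 1`. So its transform arises from the previous one, which
ends with `b`, by prepending some letters, appending a run of `a`, and appending the last letter
`b`: the number of runs grows by at least two in each step (`exists_isTransform_iterImage`). One
more application of `θ`, and the factor `a`, which contributes the first letter of the transform, do not
lower it. So `r_B(F_{2m+1})` is at least linear in `m`, while the length of `F_{2m+1}` is at most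
exponential in `m`.
-/

namespace BijectiveBWT

/-! ### Infinite powers and the `ω`-order -/

section OmegaOrder

variable {α : Type*} [LinearOrder α]

theorem infinitePower_apply {α : Type*} (x : List α) (i : ℕ) :
    infinitePower x i = (x[i % x.length]?).elim ⊥ (fun c => (c : WithBot α)) := rfl

theorem infinitePower_rotate {α : Type*} (x : List α) (k i : ℕ) :
    infinitePower (x.rotate k) i = infinitePower x (i + k) := by
  rcases eq_or_ne x [] with rfl | hx
  · simp [infinitePower_apply]
  · have h : i % x.length < x.length := Nat.mod_lt _ (List.length_pos_iff.mpr hx)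
    rw [infinitePower_apply, infinitePower_apply, List.length_rotate, List.getElem?_rotate h,
      Nat.mod_add_mod]

theorem infinitePower_cons_zero {α : Type*} (c : α) (v : List α) :
    infinitePower (c :: v) 0 = c := by
  simp [infinitePower_apply]

theorem infinitePower_cons_succ {α : Type*} (c : α) (v : List α) (i : ℕ) :
    infinitePower (c :: v) (i + 1) = infinitePower (v ++ [c]) i := by
  rw [← infinitePower_rotate]
  simp

theorem infinitePower_cons_lt_of_lt {c d : α} (h : c < d) (v w : List α) :
    infinitePower (c :: v) < infinitePower (d :: w) :=
  ⟨0, by simp, by simpa only [infinitePower_cons_zero, WithBot.coe_lt_coe] using h⟩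

theorem infinitePower_cons_lt (c : α) {v w : List α}
    (h : infinitePower (v ++ [c]) < infinitePower (w ++ [c])) :
    infinitePower (c :: v) < infinitePower (c :: w) := by
  obtain ⟨i, hi, hlt⟩ := h
  refine ⟨i + 1, fun j hj => ?_, ?_⟩
  · cases j with
    | zero => rw [infinitePower_cons_zero, infinitePower_cons_zero]
    | succ j =>
      rw [infinitePower_cons_succ, infinitePower_cons_succ]
      exact hi j (by simpa using hj)
  · rw [infinitePower_cons_succ, infinitePower_cons_succ]
    exact hlt

theorem infinitePower_cons_congr {α : Type*} (c : α) {v w : List α}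
    (h : infinitePower (v ++ [c]) = infinitePower (w ++ [c])) :
    infinitePower (c :: v) = infinitePower (c :: w) := by
  funext i
  cases i with
  | zero => rw [infinitePower_cons_zero, infinitePower_cons_zero]
  | succ i => rw [infinitePower_cons_succ, infinitePower_cons_succ, h]

theorem OmegaLE.append_left (u : List α) {v w : List α} (h : OmegaLE (v ++ u) (w ++ u)) :
    OmegaLE (u ++ v) (u ++ w) := by
  induction u generalizing v w with
  | nil => simpa using h
  | cons c u ih =>
    have h' : OmegaLE (u ++ (v ++ [c])) (u ++ (w ++ [c])) := ih (by simpa using h)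
    rcases lt_or_eq_of_le h' with h' | h'
    · refine (infinitePower_cons_lt c ?_).le
      rw [List.append_eq, List.append_eq, List.append_assoc, List.append_assoc]
      exact h'
    · refine (infinitePower_cons_congr c ?_).le
      rw [List.append_eq, List.append_eq, List.append_assoc, List.append_assoc]
      exact h'

theorem infinitePower_lt_of_lt {c d : α} (h : c < d) (p s t : List α) :
    infinitePower (p ++ c :: s) < infinitePower (p ++ d :: t) := by
  induction p generalizing s t with
  | nil => exact infinitePower_cons_lt_of_lt h s t
  | cons e p ih =>
    exact infinitePower_cons_lt e (by simpa using ih (s ++ [e]) (t ++ [e]))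

/-- Two distinct strings, neither a prefix of the other, compare at their first difference. -/
theorem exists_branch_of_lt {x y : List α} (h : x < y) (hp : ¬ x <+: y) :
    ∃ p c d s t, c < d ∧ x = p ++ c :: s ∧ y = p ++ d :: t := by
  induction x generalizing y with
  | nil => exact absurd List.nil_prefix hp
  | cons c x ih =>
    cases y with
    | nil => simp at h
    | cons d y =>
      rw [List.cons_lt_cons_iff] at h
      rcases h with h | ⟨rfl, h⟩
      · exact ⟨[], c, d, x, y, h, rfl, rfl⟩
      · obtain ⟨p, c', d', s, t, hcd, rfl, rfl⟩ := ih h (fun hp' => hp (by simpa using hp'))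
        exact ⟨c :: p, c', d', s, t, hcd, rfl, rfl⟩

/-- On strings of equal length, the `ω`-order extends the lexicographic order. -/
theorem omegaLE_of_le {x y : List α} (hl : x.length = y.length) (h : x ≤ y) : OmegaLE x y := by
  rcases lt_or_eq_of_le h with h | rfl
  · have hp : ¬ x <+: y := fun hp => h.ne (hp.eq_of_length hl)
    obtain ⟨p, c, d, s, t, hcd, rfl, rfl⟩ := exists_branch_of_lt h hp
    exact (infinitePower_lt_of_lt hcd p s t).le
  · exact le_refl (infinitePower x)

/-- The power `x x ⋯ x` with `k` factors. -/
def wordPow (x : List α) (k : ℕ) : List α := (List.replicate k x).flatten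

theorem wordPow_succ {α : Type*} (x : List α) (k : ℕ) : wordPow x (k + 1) = x ++ wordPow x k := by
  simp [wordPow, List.replicate_succ]

theorem length_wordPow {α : Type*} (x : List α) (k : ℕ) : (wordPow x k).length = k * x.length := by
  simp [wordPow]

theorem getElem?_wordPow {α : Type*} (x : List α) (k i : ℕ) (hi : i < k * x.length) :
    (wordPow x k)[i]? = x[i % x.length]? := by
  induction k generalizing i with
  | zero => simp at hi
  | succ k ih =>
    rw [wordPow_succ]
    rcases lt_or_ge i x.length with h | h
    · rw [List.getElem?_append_left h, Nat.mod_eq_of_lt h]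
    · rw [List.getElem?_append_right h, ih _ (by rw [Nat.succ_mul] at hi; omega),
        ← Nat.mod_eq_sub_mod h]

theorem infinitePower_wordPow {α : Type*} (x : List α) {k : ℕ} (hk : 0 < k) :
    infinitePower (wordPow x k) = infinitePower x := by
  rcases eq_or_ne x [] with rfl | hx
  · simp [wordPow]
  · funext i
    have hx := List.length_pos_iff.mpr hx
    rw [infinitePower_apply, infinitePower_apply, length_wordPow,
      getElem?_wordPow _ _ _ (Nat.mod_lt _ (by positivity)), Nat.mod_mul_left_mod]

theorem infinitePower_apply_of_ne_nil {α : Type*} {x : List α} (hx : x ≠ []) (i : ℕ) :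
    ∃ c ∈ x, infinitePower x i = c ∧ x[i % x.length]? = some c := by
  have h : i % x.length < x.length := Nat.mod_lt _ (List.length_pos_iff.mpr hx)
  exact ⟨x[i % x.length], List.getElem_mem h, by simp [infinitePower_apply, h], by simp [h]⟩

/-- Two strings with the same infinite power have a common power. -/
theorem wordPow_eq_of_infinitePower_eq {α : Type*} {x y : List α} (hx : x ≠ []) (hy : y ≠ [])
    (h : infinitePower x = infinitePower y) : wordPow x y.length = wordPow y x.length := by
  refine List.ext_getElem? fun i => ?_
  rcases lt_or_ge i (y.length * x.length) with hi | hi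
  · rw [getElem?_wordPow _ _ _ hi, getElem?_wordPow _ _ _ (by rwa [mul_comm])]
    obtain ⟨c, -, hc, hc'⟩ := infinitePower_apply_of_ne_nil hx i
    obtain ⟨d, -, hd, hd'⟩ := infinitePower_apply_of_ne_nil hy i
    rw [hc', hd']
    rw [h, hd] at hc
    exact congrArg some (WithBot.coe_injective hc).symm
  · rw [List.getElem?_eq_none (by rwa [length_wordPow]),
      List.getElem?_eq_none (by rwa [length_wordPow, mul_comm])]

/-- If the infinite power of `x` is smaller than that of `y`, then some powers of `x` and `y` differ
at a first position, and the letter of the power of `x` is the smaller one. -/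
theorem exists_wordPow_branch {x y : List α} (hx : x ≠ []) (hy : y ≠ [])
    (h : infinitePower x < infinitePower y) :
    ∃ k, 0 < k ∧ ∃ p c d s t, c < d ∧ wordPow x k = p ++ c :: s ∧ wordPow y k = p ++ d :: t := by
  obtain ⟨i, hi, hlt⟩ := h
  have key : ∀ {z : List α}, z ≠ [] → ∀ j ≤ i, j < (i + 1) * z.length := fun {z} hz j hj => by
    have := List.length_pos_iff.mpr hz
    nlinarith
  refine ⟨i + 1, i.succ_pos, ?_⟩
  obtain ⟨c, -, hc, hc'⟩ := infinitePower_apply_of_ne_nil hx i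
  obtain ⟨d, -, hd, hd'⟩ := infinitePower_apply_of_ne_nil hy i
  rw [hc, hd, WithBot.coe_lt_coe] at hlt
  rw [← getElem?_wordPow x (i + 1) i (key hx i le_rfl)] at hc'
  rw [← getElem?_wordPow y (i + 1) i (key hy i le_rfl)] at hd'
  obtain ⟨h1, h1'⟩ := List.getElem?_eq_some_iff.mp hc'
  obtain ⟨h2, h2'⟩ := List.getElem?_eq_some_iff.mp hd'
  have hp : (wordPow x (i + 1)).take i = (wordPow y (i + 1)).take i := by
    refine List.ext_getElem? fun j => ?_
    rcases lt_or_ge j i with hj | hj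
    · rw [List.getElem?_take_of_lt hj, List.getElem?_take_of_lt hj,
        getElem?_wordPow _ _ _ (key hx j hj.le), getElem?_wordPow _ _ _ (key hy j hj.le)]
      obtain ⟨c, -, hc, hc'⟩ := infinitePower_apply_of_ne_nil hx j
      obtain ⟨d, -, hd, hd'⟩ := infinitePower_apply_of_ne_nil hy j
      rw [hc', hd']
      rw [hi j hj, hd] at hc
      exact congrArg some (WithBot.coe_injective hc).symm
    · rw [List.getElem?_eq_none (by simp [hj]), List.getElem?_eq_none (by simp [hj])]
  refine ⟨(wordPow x (i + 1)).take i, c, d, (wordPow x (i + 1)).drop (i + 1),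
    (wordPow y (i + 1)).drop (i + 1), hlt, ?_, ?_⟩
  · rw [← h1', List.getElem_cons_drop, List.take_append_drop]
  · rw [hp, ← h2', List.getElem_cons_drop, List.take_append_drop]

theorem getLast?_wordPow {α : Type*} (x : List α) {k : ℕ} (hk : 0 < k) :
    (wordPow x k).getLast? = x.getLast? := by
  obtain ⟨k, rfl⟩ := Nat.exists_eq_add_one.mpr hk
  rcases eq_or_ne x [] with rfl | hx
  · simp [wordPow]
  · rw [wordPow, List.replicate_succ', List.flatten_append]
    simp [List.getLast?_append_of_ne_nil _ hx]

/-- `ω`-equivalent strings have the same last symbol: ties in the `ω`-order do not matter for the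
transform. -/
theorem getLast?_eq_of_infinitePower_eq {α : Type*} {x y : List α} (hx : x ≠ []) (hy : y ≠ [])
    (h : infinitePower x = infinitePower y) : x.getLast? = y.getLast? := by
  rw [← getLast?_wordPow x (List.length_pos_iff.mpr hy),
    wordPow_eq_of_infinitePower_eq hx hy h, getLast?_wordPow y (List.length_pos_iff.mpr hx)]

/-- Any two `ω`-sorted arrangements of the same nonempty strings have the same last symbols. -/
theorem lastSymbols_eq_of_perm {S T : List (List α)} (hST : S.Perm T) (hne : ∀ x ∈ S, x ≠ [])
    (hS : S.Pairwise OmegaLE) (hT : T.Pairwise OmegaLE) : lastSymbols S = lastSymbols T := by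
  have hmap : S.map infinitePower = T.map infinitePower :=
    (hST.map infinitePower).eq_of_pairwise (fun _ _ _ _ h1 h2 => le_antisymm h1 h2)
      (List.pairwise_map.mpr hS) (List.pairwise_map.mpr hT)
  have hne' : ∀ x ∈ T, x ≠ [] := fun x hx => hne x (hST.mem_iff.mpr hx)
  clear hST hS hT
  induction S generalizing T with
  | nil =>
    cases T with
    | nil => rfl
    | cons y T => simp at hmap
  | cons x S ih =>
    cases T with
    | nil => simp at hmap
    | cons y T =>
      rw [List.map_cons, List.map_cons, List.cons.injEq] at hmap
      have h1 := getLast?_eq_of_infinitePower_eq (hne x (by simp)) (hne' y (by simp)) hmap.1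
      have h2 := ih (fun z hz => hne z (by simp [hz])) hmap.2 (fun z hz => hne' z (by simp [hz]))
      simp only [lastSymbols, List.filterMap_cons, h1] at h2 ⊢
      rw [h2]

end OmegaOrder

/-! ### The transform of a collection of strings -/

section Collections

variable {α : Type*} [LinearOrder α]

/-- `t` is the string of last symbols of all rotations of all members of `M` in `ω`-order, for
some `ω`-sorted arrangement of these rotations. This relational form of the transform avoids
reference to a sorting algorithm and to a Lyndon factorization. -/
def IsTransform (M : List (List α)) (t : List α) : Prop :=
  ∃ S : List (List α), S.Perm (M.flatMap rotations) ∧ S.Pairwise OmegaLE ∧ lastSymbols S = t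

theorem mem_rotations {α : Type*} {w x : List α} (h : x ∈ rotations w) : ∃ i, x = w.rotate i := by
  obtain ⟨i, -, rfl⟩ := List.mem_map.mp h
  exact ⟨i, rfl⟩

theorem ne_nil_of_mem_rotations {α : Type*} {w x : List α} (h : x ∈ rotations w) : x ≠ [] := by
  obtain ⟨i, hi, rfl⟩ := List.mem_map.mp h
  rintro h0
  rw [List.rotate_eq_nil_iff] at h0
  simp [h0] at hi

theorem rotations_rotate_perm {α : Type*} (w : List α) (k : ℕ) :
    (rotations (w.rotate k)).Perm (rotations w) := by
  rcases eq_or_ne w [] with rfl | hw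
  · simp
  · have key : ∀ v : List α, v ≠ [] → rotations v = v.cyclicPermutations := fun v hv => by
      refine List.ext_getElem (by simp [rotations, List.length_cyclicPermutations_of_ne_nil v hv])
        fun i h1 h2 => ?_
      simp [rotations, List.getElem_cyclicPermutations]
    rw [key _ hw, key _ (by simpa using hw), List.cyclicPermutations_rotate]
    exact List.rotate_perm _ _

theorem IsTransform.perm {M N : List (List α)} {t : List α} (h : IsTransform M t)
    (hMN : (M.flatMap rotations).Perm (N.flatMap rotations)) : IsTransform N t := by
  obtain ⟨S, h1, h2, h3⟩ := h
  exact ⟨S, h1.trans hMN, h2, h3⟩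

theorem IsTransform.bbwt_eq {w t : List α} (h : IsTransform (lyndonFactorization w) t) :
    bbwt w = t := by
  classical
  obtain ⟨S, h1, h2, rfl⟩ := h
  refine lastSymbols_eq_of_perm ((List.mergeSort_perm _ _).trans h1.symm) ?_ ?_ h2
  · intro x hx
    obtain ⟨w, -, hw⟩ := List.mem_flatMap.mp ((List.mergeSort_perm _ _).mem_iff.mp hx)
    exact ne_nil_of_mem_rotations hw
  · refine (List.pairwise_mergeSort ?_ ?_ _).imp fun h => of_decide_eq_true h
    · intro x y z hxy hyz
      simp only [decide_eq_true_eq] at *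
      exact le_trans (α := Lex (ℕ → WithBot α)) hxy hyz
    · intro x y
      simp only [Bool.or_eq_true, decide_eq_true_eq]
      exact le_total (infinitePower x) (infinitePower y)

/-- The rotations of a single string have equal length, so their lexicographic order is their
`ω`-order. -/
theorem IsTransform.bwt_eq {w t : List α} (h : IsTransform [w] t) : bwt w = t := by
  obtain ⟨S, h1, h2, rfl⟩ := h
  rw [List.flatMap_singleton] at h1
  have hmem : ∀ x ∈ (rotations w).mergeSort (fun x y => decide (x ≤ y)), x ∈ rotations w :=
    fun x hx => (List.mergeSort_perm _ _).mem_iff.mp hx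
  refine lastSymbols_eq_of_perm ((List.mergeSort_perm _ _).trans h1.symm)
    (fun x hx => ne_nil_of_mem_rotations (hmem x hx)) ?_ h2
  have hsort := List.pairwise_mergeSort (le := fun x y : List α => decide (x ≤ y))
    (fun x y z hxy hyz => by
      simp only [decide_eq_true_eq] at *
      exact hxy.trans hyz)
    (fun x y => by simpa using le_total x y) (rotations w)
  refine hsort.imp_of_mem fun {x y} hx hy hxy => ?_
  obtain ⟨i, rfl⟩ := mem_rotations (hmem _ hx)
  obtain ⟨j, rfl⟩ := mem_rotations (hmem _ hy)
  exact omegaLE_of_le (by simp) (of_decide_eq_true hxy)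

theorem omegaLE_of_forall_le {x y : List α} (h : ∀ i, infinitePower x i ≤ infinitePower y i) :
    OmegaLE x y :=
  Pi.toLex_monotone h

theorem rotations_singleton {α : Type*} (c : α) : rotations [c] = [[c]] := by
  simp [rotations]

theorem infinitePower_singleton {α : Type*} (c : α) (i : ℕ) : infinitePower [c] i = c := by
  simp [infinitePower_apply, Nat.mod_one]

theorem mem_of_mem_rotations {α : Type*} {M : List (List α)} {x : List α}
    (h : x ∈ M.flatMap rotations) {c : α} (hc : c ∈ x) : ∃ w ∈ M, c ∈ w := by
  obtain ⟨w, hw, hx⟩ := List.mem_flatMap.mp h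
  obtain ⟨i, rfl⟩ := mem_rotations hx
  exact ⟨w, hw, List.mem_rotate.mp hc⟩

/-- The one-letter string over a largest letter contributes the last symbol of the transform. -/
theorem IsTransform.cons_max {M : List (List α)} {t : List α} (h : IsTransform M t) {b : α}
    (hb : ∀ w ∈ M, ∀ c ∈ w, c ≤ b) : IsTransform ([b] :: M) (t ++ [b]) := by
  obtain ⟨S, h1, h2, rfl⟩ := h
  refine ⟨S ++ [[b]], ?_, ?_, by simp [lastSymbols]⟩
  · rw [List.flatMap_cons, rotations_singleton]
    exact List.perm_append_comm.trans (h1.append_left _)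
  · refine List.pairwise_append.mpr ⟨h2, by simp, fun x hx y hy => ?_⟩
    obtain rfl := List.mem_singleton.mp hy
    have hx := h1.mem_iff.mp hx
    have hne : x ≠ [] := by
      obtain ⟨w, -, hw⟩ := List.mem_flatMap.mp hx
      exact ne_nil_of_mem_rotations hw
    refine omegaLE_of_forall_le fun i => ?_
    obtain ⟨c, hc, hci, -⟩ := infinitePower_apply_of_ne_nil hne i
    obtain ⟨w, hw, hcw⟩ := mem_of_mem_rotations hx hc
    rw [infinitePower_singleton, hci, WithBot.coe_le_coe]
    exact hb w hw c hcw

/-- The one-letter string over a smallest letter contributes the first symbol of the transform. -/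
theorem IsTransform.append_min {M : List (List α)} {t : List α} (h : IsTransform M t) {a : α}
    (ha : ∀ w ∈ M, ∀ c ∈ w, a ≤ c) : IsTransform (M ++ [[a]]) (a :: t) := by
  obtain ⟨S, h1, h2, rfl⟩ := h
  refine ⟨[a] :: S, ?_, ?_, by simp [lastSymbols]⟩
  · rw [List.flatMap_append, List.flatMap_singleton, rotations_singleton]
    exact (List.perm_append_comm (l₁ := [[a]])).trans (h1.append_right _)
  · refine List.pairwise_cons.mpr ⟨fun x hx => ?_, h2⟩
    have hx := h1.mem_iff.mp hx
    have hne : x ≠ [] := by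
      obtain ⟨w, -, hw⟩ := List.mem_flatMap.mp hx
      exact ne_nil_of_mem_rotations hw
    refine omegaLE_of_forall_le fun i => ?_
    obtain ⟨c, hc, hci, -⟩ := infinitePower_apply_of_ne_nil hne i
    obtain ⟨w, hw, hcw⟩ := mem_of_mem_rotations hx hc
    rw [infinitePower_singleton, hci, WithBot.coe_le_coe]
    exact ha w hw c hcw

end Collections

/-! ### The morphism `a ↦ aab`, `b ↦ ab` -/

section Morphism

variable {α : Type*} [LinearOrder α]

/-- The morphism `a ↦ aab`, `b ↦ ab`, which preserves the lexicographic order when `a < b`. It is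
meant for strings over `{a, b}`; every letter other than `a` is mapped to `ab`. -/
def fibMorphism (a b : α) (w : List α) : List α :=
  w.flatMap (fun c => if c = a then [a, a, b] else [a, b])

/-- The string `w` uses only the letters `a` and `b`. -/
def IsOver (a b : α) (w : List α) : Prop := ∀ c ∈ w, c = a ∨ c = b

variable {a b : α}

theorem fibMorphism_nil : fibMorphism a b [] = [] := rfl

theorem fibMorphism_append (u v : List α) :
    fibMorphism a b (u ++ v) = fibMorphism a b u ++ fibMorphism a b v := by
  simp [fibMorphism]

theorem fibMorphism_cons_left (v : List α) :
    fibMorphism a b (a :: v) = [a, a, b] ++ fibMorphism a b v := by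
  simp [fibMorphism]

theorem fibMorphism_cons_right (hab : a < b) (v : List α) :
    fibMorphism a b (b :: v) = [a, b] ++ fibMorphism a b v := by
  simp [fibMorphism, hab.ne']

theorem fibMorphism_wordPow (x : List α) (k : ℕ) :
    fibMorphism a b (wordPow x k) = wordPow (fibMorphism a b x) k := by
  induction k with
  | zero => rfl
  | succ k ih => rw [wordPow_succ, wordPow_succ, fibMorphism_append, ih]

theorem isOver_append {α : Type*} {a b : α} {u v : List α} :
    IsOver a b (u ++ v) ↔ IsOver a b u ∧ IsOver a b v := by
  simp only [IsOver, List.mem_append, or_imp, forall_and]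

theorem isOver_fibMorphism (w : List α) : IsOver a b (fibMorphism a b w) := by
  intro c hc
  obtain ⟨d, -, hd⟩ := List.mem_flatMap.mp hc
  split_ifs at hd <;> simp at hd <;> tauto

theorem isOver_wordPow {α : Type*} {a b : α} {x : List α} (hx : IsOver a b x) (k : ℕ) :
    IsOver a b (wordPow x k) := by
  intro c hc
  obtain ⟨y, hy, hcy⟩ := List.mem_flatten.mp hc
  rw [List.eq_of_mem_replicate hy] at hcy
  exact hx c hcy

theorem getLast?_fibMorphism {w : List α} (hw : w ≠ []) :
    (fibMorphism a b w).getLast? = some b := by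
  obtain ⟨v, c, rfl⟩ := (List.eq_nil_or_concat' _).resolve_left hw
  rw [fibMorphism_append, List.getLast?_append]
  by_cases hc : c = a <;> simp [fibMorphism, hc]

/-- The morphism preserves the `ω`-order: a first difference `a` versus `b` after a common prefix
`p` of powers becomes the first difference `a` versus `b` after the image of `p` and one more
letter `a`. -/
theorem OmegaLE.fibMorphism (hab : a < b) {x y : List α} (hx : x ≠ []) (hy : y ≠ [])
    (hxo : IsOver a b x) (hyo : IsOver a b y) (h : OmegaLE x y) :
    OmegaLE (fibMorphism a b x) (fibMorphism a b y) := by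
  rcases lt_or_eq_of_le h with h | h
  · obtain ⟨k, hk, p, c, d, s, t, hcd, hs, ht⟩ := exists_wordPow_branch hx hy h
    have hc : c = a ∨ c = b := isOver_wordPow hxo k c (by simp [hs])
    have hd : d = a ∨ d = b := isOver_wordPow hyo k d (by simp [ht])
    obtain ⟨rfl, rfl⟩ : c = a ∧ d = b := by
      rcases hc with rfl | rfl <;> rcases hd with rfl | rfl
      · exact absurd hcd (lt_irrefl _)
      · exact ⟨rfl, rfl⟩
      · exact absurd hcd hab.asymm
      · exact absurd hcd (lt_irrefl _)
    have key := infinitePower_lt_of_lt hab (BijectiveBWT.fibMorphism c d p ++ [c])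
      (d :: BijectiveBWT.fibMorphism c d s) (BijectiveBWT.fibMorphism c d t)
    have hs' := congrArg (BijectiveBWT.fibMorphism c d) hs
    have ht' := congrArg (BijectiveBWT.fibMorphism c d) ht
    rw [fibMorphism_wordPow, fibMorphism_append, fibMorphism_cons_left] at hs'
    rw [fibMorphism_wordPow, fibMorphism_append, fibMorphism_cons_right hab] at ht'
    refine le_of_lt ?_
    rw [← infinitePower_wordPow (BijectiveBWT.fibMorphism c d x) hk, hs',
      ← infinitePower_wordPow (BijectiveBWT.fibMorphism c d y) hk, ht']
    rw [List.append_assoc, List.append_assoc] at key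
    exact key
  · refine le_of_eq ?_
    rw [← infinitePower_wordPow _ (List.length_pos_iff.mpr hy), ← fibMorphism_wordPow,
      wordPow_eq_of_infinitePower_eq hx hy h, fibMorphism_wordPow,
      infinitePower_wordPow _ (List.length_pos_iff.mpr hx)]

/-! ### Rotations of an image under the morphism -/

/-- The right rotation of the image of `y` that brings the suffix `u` to the front. It is used only
for suffixes `u` of the image. -/
def bringToFront (a b : α) (u y : List α) : List α :=
  u ++ (fibMorphism a b y).take ((fibMorphism a b y).length - u.length)

theorem bringToFront_eq {u y s : List α} (h : fibMorphism a b y = s ++ u) :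
    bringToFront a b u y = u ++ s := by
  simp [bringToFront, h]

theorem bringToFront_b_of_last_a (v : List α) :
    bringToFront a b [b] (v ++ [a]) = b :: (fibMorphism a b v ++ [a, a]) := by
  rw [bringToFront_eq (s := fibMorphism a b v ++ [a, a])]
  · simp
  · simp [fibMorphism]

theorem bringToFront_ab_of_last_a (v : List α) :
    bringToFront a b [a, b] (v ++ [a]) = a :: b :: (fibMorphism a b v ++ [a]) := by
  rw [bringToFront_eq (s := fibMorphism a b v ++ [a])]
  · simp
  · simp [fibMorphism]

theorem bringToFront_aab_of_last_a (v : List α) :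
    bringToFront a b [a, a, b] (v ++ [a]) = a :: a :: b :: fibMorphism a b v := by
  rw [bringToFront_eq (s := fibMorphism a b v)]
  · simp
  · simp [fibMorphism]

theorem bringToFront_b_of_last_b (hab : a < b) (v : List α) :
    bringToFront a b [b] (v ++ [b]) = b :: (fibMorphism a b v ++ [a]) := by
  rw [bringToFront_eq (s := fibMorphism a b v ++ [a])]
  · simp
  · simp [fibMorphism, hab.ne']

theorem bringToFront_ab_of_last_b (hab : a < b) (v : List α) :
    bringToFront a b [a, b] (v ++ [b]) = a :: b :: fibMorphism a b v := by
  rw [bringToFront_eq (s := fibMorphism a b v)]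
  · simp
  · simp [fibMorphism, hab.ne']

/-- The rotations of the image of `y` that start inside the image of the last letter of `y`. -/
def lastBlockRotations (a b : α) (y : List α) : List (List α) :=
  (if y.getLast? = some a then [bringToFront a b [a, a, b] y] else []) ++
    ([bringToFront a b [a, b] y] ++ [bringToFront a b [b] y])

theorem lastBlockRotations_of_last_a (v : List α) :
    lastBlockRotations a b (v ++ [a]) = [a :: a :: b :: fibMorphism a b v,
      a :: b :: (fibMorphism a b v ++ [a]), b :: (fibMorphism a b v ++ [a, a])] := by
  simp [lastBlockRotations, bringToFront_aab_of_last_a, bringToFront_ab_of_last_a,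
    bringToFront_b_of_last_a]

theorem lastBlockRotations_of_last_b (hab : a < b) (v : List α) :
    lastBlockRotations a b (v ++ [b]) =
      [a :: b :: fibMorphism a b v, b :: (fibMorphism a b v ++ [a])] := by
  simp [lastBlockRotations, bringToFront_ab_of_last_b hab, bringToFront_b_of_last_b hab, hab.ne']

/-- The first `|v|` rotations of `v ++ u`. -/
def firstRotations (u v : List α) : List (List α) :=
  (List.range v.length).map (fun i => (v ++ u).rotate i)

theorem firstRotations_cons {α : Type*} (u v : List α) (c : α) :
    firstRotations u (c :: v) = (c :: (v ++ u)) :: firstRotations (u ++ [c]) v := by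
  simp [firstRotations, List.range_succ_eq_map, Function.comp_def]

theorem firstRotations_fibMorphism (hab : a < b) (u v : List α) (hv : IsOver a b v) :
    firstRotations (fibMorphism a b u) (fibMorphism a b v) =
      (firstRotations u v).flatMap (fun x => lastBlockRotations a b (x.rotate 1)) := by
  induction v generalizing u with
  | nil => simp [firstRotations, fibMorphism]
  | cons c v ih =>
    have ih := ih (u ++ [c]) (fun d hd => hv d (by simp [hd]))
    rw [firstRotations_cons, List.flatMap_cons, ← ih, fibMorphism_append]
    rcases hv c (by simp) with rfl | rfl
    · rw [List.rotate_cons_succ, List.rotate_zero, lastBlockRotations_of_last_a,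
        fibMorphism_cons_left, fibMorphism_append, fibMorphism_cons_left]
      simp [firstRotations_cons, fibMorphism_nil]
    · rw [List.rotate_cons_succ, List.rotate_zero, lastBlockRotations_of_last_b hab,
        fibMorphism_cons_right hab, fibMorphism_append, fibMorphism_cons_right hab]
      simp [firstRotations_cons, fibMorphism_nil]

theorem rotations_fibMorphism_perm (hab : a < b) (w : List α) (hw : IsOver a b w) :
    (rotations (fibMorphism a b w)).Perm ((rotations w).flatMap (lastBlockRotations a b)) := by
  have h := firstRotations_fibMorphism hab [] w hw
  have hrot : ∀ v : List α, firstRotations [] v = rotations v := fun v => by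
    simp [firstRotations, rotations]
  rw [fibMorphism_nil, hrot, hrot] at h
  have hmap : (rotations w).map (fun x => x.rotate 1) = rotations (w.rotate 1) := by
    simp [rotations, List.rotate_rotate, Function.comp_def, add_comm]
  have h' : (rotations w).flatMap (fun x => lastBlockRotations a b (x.rotate 1)) =
      (rotations (w.rotate 1)).flatMap (lastBlockRotations a b) := by
    rw [← hmap, List.flatMap_map]
  rw [h, h']
  refine List.Perm.flatMap_right _ ?_
  exact rotations_rotate_perm w 1

/-! ### The transform of an image under the morphism -/

theorem omegaLE_bringToFront (hab : a < b) {u x y : List α} (hx : x ≠ []) (hy : y ≠ [])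
    (hxo : IsOver a b x) (hyo : IsOver a b y) (hux : u <:+ fibMorphism a b x)
    (huy : u <:+ fibMorphism a b y) (h : OmegaLE x y) :
    OmegaLE (bringToFront a b u x) (bringToFront a b u y) := by
  have h := h.fibMorphism hab hx hy hxo hyo
  obtain ⟨s, hs⟩ := hux
  obtain ⟨t, ht⟩ := huy
  rw [bringToFront_eq hs.symm, bringToFront_eq ht.symm]
  rw [← hs, ← ht] at h
  exact h.append_left u

theorem ab_suffix_fibMorphism {y : List α} (hy : y ≠ []) : [a, b] <:+ fibMorphism a b y := by
  obtain ⟨v, c, rfl⟩ := (List.eq_nil_or_concat' _).resolve_left hy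
  rw [fibMorphism_append]
  by_cases hc : c = a
  · exact ⟨fibMorphism a b v ++ [a], by simp [fibMorphism, hc]⟩
  · exact ⟨fibMorphism a b v, by simp [fibMorphism, hc]⟩

theorem aab_suffix_fibMorphism {y : List α} (hy : y.getLast? = some a) :
    [a, a, b] <:+ fibMorphism a b y := by
  obtain ⟨v, rfl⟩ := List.getLast?_eq_some_iff.mp hy
  exact ⟨fibMorphism a b v, by simp [fibMorphism]⟩

theorem lastSymbols_map_aab (S : List (List α)) :
    lastSymbols ((S.filter (fun y => y.getLast? = some a)).map (bringToFront a b [a, a, b])) =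
      List.replicate ((lastSymbols S).count a) b := by
  induction S with
  | nil => rfl
  | cons y S ih =>
    by_cases hy : y.getLast? = some a
    · have hlast : (bringToFront a b [a, a, b] y).getLast? = some b := by
        obtain ⟨v, rfl⟩ := List.getLast?_eq_some_iff.mp hy
        rw [bringToFront_aab_of_last_a]
        rcases eq_or_ne v [] with rfl | hv
        · rfl
        · simp [List.getLast?_cons, getLast?_fibMorphism hv]
      simp only [lastSymbols] at ih ⊢
      simp [hy, ih, hlast, List.replicate_succ]
    · simp only [lastSymbols] at ih ⊢
      rcases hl : y.getLast? with _ | c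
      · simp [hl, ih]
      · have hc : c ≠ a := fun h => hy (h ▸ hl)
        simp [hl, ih, hc]

theorem lastSymbols_map_ab (hab : a < b) (S : List (List α))
    (hS : ∀ y ∈ S, y ≠ [] ∧ IsOver a b y) :
    lastSymbols (S.map (bringToFront a b [a, b])) = lastSymbols S := by
  induction S with
  | nil => rfl
  | cons y S ih =>
    have ih := ih (fun z hz => hS z (by simp [hz]))
    have hlast : (bringToFront a b [a, b] y).getLast? = y.getLast? := by
      obtain ⟨hne, ho⟩ := hS y (by simp)
      obtain ⟨v, c, rfl⟩ := (List.eq_nil_or_concat' _).resolve_left hne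
      rcases ho c (by simp) with rfl | rfl
      · rw [bringToFront_ab_of_last_a]
        simp [List.getLast?_cons]
      · rw [bringToFront_ab_of_last_b hab]
        rcases eq_or_ne v [] with rfl | hv
        · simp [fibMorphism]
        · simp [List.getLast?_cons, getLast?_fibMorphism hv]
    simp only [lastSymbols] at ih ⊢
    simp only [List.map_cons, List.filterMap_cons, hlast, ih]

theorem lastSymbols_map_b (hab : a < b) (S : List (List α))
    (hS : ∀ y ∈ S, y ≠ [] ∧ IsOver a b y) :
    lastSymbols (S.map (bringToFront a b [b])) = List.replicate (lastSymbols S).length a := by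
  induction S with
  | nil => rfl
  | cons y S ih =>
    have ih := ih (fun z hz => hS z (by simp [hz]))
    obtain ⟨hne, ho⟩ := hS y (by simp)
    obtain ⟨v, c, rfl⟩ := (List.eq_nil_or_concat' _).resolve_left hne
    have hlast : (bringToFront a b [b] (v ++ [c])).getLast? = some a := by
      rcases ho c (by simp) with rfl | rfl
      · rw [bringToFront_b_of_last_a]
        simp [List.getLast?_cons]
      · rw [bringToFront_b_of_last_b hab]
        simp [List.getLast?_cons]
    simp only [lastSymbols] at ih ⊢
    simp [hlast, ih, List.replicate_succ]

/-- Let `θ` be the morphism. The rotations of the images start with `aa`, `ab` or `b`.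
Those starting with `aa` are preceded by `b`, those starting with `b` are preceded by `a`, and those
starting with `ab` have, in order, the infinite powers `ab θ(y)^∞` for the rotations `y` of the
original strings, and are preceded by the letter that precedes `y`. -/
theorem IsTransform.map_fibMorphism (hab : a < b) {M : List (List α)} {t : List α}
    (hM : ∀ w ∈ M, IsOver a b w) (h : IsTransform M t) :
    IsTransform (M.map (BijectiveBWT.fibMorphism a b))
      (List.replicate (t.count a) b ++ (t ++ List.replicate t.length a)) := by
  obtain ⟨S, h1, h2, rfl⟩ := h
  have hS : ∀ y ∈ S, y ≠ [] ∧ IsOver a b y := fun y hy => by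
    have hy := h1.mem_iff.mp hy
    refine ⟨?_, fun c hc => ?_⟩
    · obtain ⟨w, -, hw⟩ := List.mem_flatMap.mp hy
      exact ne_nil_of_mem_rotations hw
    · obtain ⟨w, hw, hcw⟩ := mem_of_mem_rotations hy hc
      exact hM w hw c hcw
  refine ⟨(S.filter (fun y => y.getLast? = some a)).map (bringToFront a b [a, a, b]) ++
    (S.map (bringToFront a b [a, b]) ++ S.map (bringToFront a b [b])), ?_, ?_, ?_⟩
  · have hfilter : S.flatMap (fun y =>
        if y.getLast? = some a then [bringToFront a b [a, a, b] y] else []) =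
        (S.filter (fun y => y.getLast? = some a)).map (bringToFront a b [a, a, b]) := by
      clear h1 h2 hS
      induction S with
      | nil => rfl
      | cons y S ih => by_cases hy : y.getLast? = some a <;> simp [hy, ih]
    have hperm : (S.flatMap (lastBlockRotations a b)).Perm
        ((M.map (BijectiveBWT.fibMorphism a b)).flatMap rotations) := by
      refine (h1.flatMap_right _).trans ?_
      rw [List.flatMap_assoc, List.flatMap_map]
      exact List.Perm.flatMap_left _ fun w hw => (rotations_fibMorphism_perm hab w (hM w hw)).symm
    refine List.Perm.trans ?_ hperm
    rw [← hfilter, ← List.flatMap_pure_eq_map, ← List.flatMap_pure_eq_map]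
    exact ((List.flatMap_append_perm S _ _).append_left _).trans (List.flatMap_append_perm S _ _)
  · have hmono : ∀ u : List α, (∀ y ∈ S, u <:+ BijectiveBWT.fibMorphism a b y) →
        (S.map (bringToFront a b u)).Pairwise OmegaLE := fun u hu =>
      List.pairwise_map.mpr (h2.imp_of_mem fun {x y} hx hy hxy =>
        omegaLE_bringToFront hab (hS x hx).1 (hS y hy).1 (hS x hx).2 (hS y hy).2
          (hu x hx) (hu y hy) hxy)
    refine List.pairwise_append.mpr ⟨?_, List.pairwise_append.mpr ⟨?_, ?_, ?_⟩, ?_⟩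
    · refine List.pairwise_map.mpr ((h2.filter _).imp_of_mem fun {x y} hx hy hxy => ?_)
      obtain ⟨hx, hxa⟩ := List.mem_filter.mp hx
      obtain ⟨hy, hya⟩ := List.mem_filter.mp hy
      exact omegaLE_bringToFront hab (hS x hx).1 (hS y hy).1 (hS x hx).2 (hS y hy).2
        (aab_suffix_fibMorphism (by simpa using hxa)) (aab_suffix_fibMorphism (by simpa using hya))
        hxy
    · exact hmono _ fun y hy => ab_suffix_fibMorphism (hS y hy).1
    · exact hmono _ fun y hy =>
        List.IsSuffix.trans ⟨[a], rfl⟩ (ab_suffix_fibMorphism (a := a) (hS y hy).1)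
    · intro x hx y hy
      obtain ⟨x, -, rfl⟩ := List.mem_map.mp hx
      obtain ⟨y, -, rfl⟩ := List.mem_map.mp hy
      exact (infinitePower_cons_lt_of_lt hab _ _).le
    · intro x hx y hy
      obtain ⟨x, -, rfl⟩ := List.mem_map.mp hx
      rcases List.mem_append.mp hy with hy | hy
      · obtain ⟨y, -, rfl⟩ := List.mem_map.mp hy
        exact (infinitePower_lt_of_lt hab [a] _ _).le
      · obtain ⟨y, -, rfl⟩ := List.mem_map.mp hy
        exact (infinitePower_cons_lt_of_lt hab _ _).le
  · have happ : ∀ l l' : List (List α), lastSymbols (l ++ l') = lastSymbols l ++ lastSymbols l' :=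
      fun l l' => List.filterMap_append
    rw [happ, happ, lastSymbols_map_aab, lastSymbols_map_ab hab S hS, lastSymbols_map_b hab S hS]

end Morphism

/-! ### Counting runs -/

section Runs

variable {α : Type*} [LinearOrder α]

theorem numRuns_replicate (c : α) {n : ℕ} (hn : 0 < n) : numRuns (List.replicate n c) = 1 := by
  have h : (List.replicate n c).IsChain (fun x y => decide (x = y) = true) :=
    List.isChain_replicate_of_rel n (by simp)
  rw [numRuns, List.splitBy_of_isChain (by simp [hn.ne']) h]
  rfl

theorem numRuns_append {x y : List α}
    (h : ∀ c ∈ x.getLast?, ∀ d ∈ y.head?, c ≠ d) : numRuns (x ++ y) = numRuns x + numRuns y := by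
  rw [numRuns, List.splitBy_append (by simpa using h), List.length_append]
  rfl

theorem numRuns_le_numRuns_cons (c : α) (x : List α) : numRuns x ≤ numRuns (c :: x) := by
  -- Split off the longest prefix of `x` that consists of the letter `c`.
  obtain ⟨n, y, hy, rfl⟩ : ∃ n y, (∀ d ∈ y.head?, c ≠ d) ∧ x = List.replicate n c ++ y := by
    induction x with
    | nil => exact ⟨0, [], by simp, rfl⟩
    | cons d x ih =>
      rcases eq_or_ne c d with rfl | hcd
      · obtain ⟨n, y, hy, rfl⟩ := ih
        exact ⟨n + 1, y, hy, rfl⟩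
      · exact ⟨0, d :: x, by simpa using hcd, rfl⟩
  have key : ∀ k, numRuns (List.replicate k c ++ y) = numRuns (List.replicate k c) + numRuns y := by
    refine fun k => numRuns_append fun e he d hd => ?_
    rw [List.eq_of_mem_replicate (List.mem_of_getLast? he)]
    exact hy d hd
  rw [← List.cons_append, ← List.replicate_succ, key, key, numRuns_replicate c n.succ_pos]
  rcases Nat.eq_zero_or_pos n with rfl | hn
  · simp [numRuns]
  · rw [numRuns_replicate c hn]

theorem numRuns_le_numRuns_append (y x : List α) : numRuns x ≤ numRuns (y ++ x) := by
  induction y with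
  | nil => exact le_rfl
  | cons c y ih => exact ih.trans (numRuns_le_numRuns_cons c (y ++ x))

end Runs

/-! ### Fibonacci words -/

section Fibonacci

variable {α : Type*} [LinearOrder α] {a b : α}

theorem length_fibWord {α : Type*} {a b : α} (k : ℕ) :
    (fibWord a b k).length = Nat.fib (k + 1) := by
  induction k using Nat.twoStepInduction with
  | zero => rfl
  | one => rfl
  | more k ih1 ih2 =>
    rw [fibWord, List.length_append, ih1, ih2, Nat.fib_add_two (n := k + 1), add_comm]

theorem length_fibWord_le {α : Type*} {a b : α} (k : ℕ) : (fibWord a b k).length ≤ 2 ^ k := by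
  induction k using Nat.twoStepInduction with
  | zero => simp [fibWord]
  | one => simp [fibWord]
  | more k ih1 ih2 =>
    rw [fibWord, List.length_append]
    have : 2 ^ k ≤ 2 ^ (k + 1) := Nat.pow_le_pow_right (by norm_num) (Nat.le_succ k)
    rw [pow_succ 2 (k + 1)]
    omega

theorem isOver_fibWord {α : Type*} {a b : α} (k : ℕ) : IsOver a b (fibWord a b k) := by
  induction k using Nat.twoStepInduction with
  | zero => simp [fibWord, IsOver]
  | one => simp [fibWord, IsOver]
  | more k ih1 ih2 => exact isOver_append.mpr ⟨ih2, ih1⟩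

/-- The morphism shifts the index of Fibonacci words by `2`, up to conjugation by `ab`. -/
theorem fibWord_add_two_append (hab : a < b) (k : ℕ) :
    fibWord a b (k + 2) ++ [a, b] = [a, b] ++ fibMorphism a b (fibWord a b k) := by
  induction k using Nat.twoStepInduction with
  | zero => simp [fibWord, fibMorphism, hab.ne']
  | one => simp [fibWord, fibMorphism]
  | more k ih1 ih2 =>
    rw [fibWord, List.append_assoc, ih1, ← List.append_assoc, ih2, fibWord, fibMorphism_append,
      List.append_assoc]

theorem fibMorphism_fibWord (hab : a < b) (k : ℕ) :
    fibMorphism a b (fibWord a b k) = (fibWord a b (k + 2)).rotate 2 := by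
  have h := fibWord_add_two_append hab k
  rcases List.append_eq_append_iff.mp h with ⟨s, hs, ht⟩ | ⟨s, hs, ht⟩
  · have h1 := congrArg List.length hs
    have h2 : 0 < Nat.fib (k + 1) := Nat.fib_pos.mpr k.succ_pos
    have h3 : 0 < Nat.fib (k + 1 + 1) := Nat.fib_pos.mpr (k + 1).succ_pos
    rw [List.length_append, length_fibWord, Nat.fib_add_two (n := k + 1)] at h1
    simp only [List.length_cons, List.length_nil] at h1
    obtain rfl : s = [] := List.length_eq_zero_iff.mp (by omega)
    rw [List.append_nil] at hs
    rw [List.nil_append] at ht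
    rw [← ht, ← hs]
    exact (List.rotate_length (l := [a, b])).symm
  · rw [hs, ht]
    simp

/-- The Burrows-Wheeler transform of a Fibonacci word of odd index has the form `b⋯ba⋯a`. -/
theorem exists_isTransform_fibWord (hab : a < b) (m : ℕ) :
    ∃ p q, IsTransform [fibWord a b (2 * m + 1)]
      (List.replicate (p + m) b ++ List.replicate (q + 1) a) := by
  induction m with
  | zero =>
    refine ⟨0, 0, [[a]], ?_, by simp, by simp [lastSymbols]⟩
    simp [fibWord, rotations]
  | succ m ih =>
    obtain ⟨p, q, h⟩ := ih
    have h := h.map_fibMorphism hab (by simpa using isOver_fibWord _)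
    refine ⟨q + p, p + m + 2 * q + 1,
      IsTransform.perm (M := [fibMorphism a b (fibWord a b (2 * m + 1))]) ?_ ?_⟩
    · have hcount : (List.replicate (p + m) b ++ List.replicate (q + 1) a).count a = q + 1 := by
        simp [List.count_replicate, hab.ne']
      have hlen : (List.replicate (p + m) b ++ List.replicate (q + 1) a).length =
          p + m + (q + 1) := by simp
      rw [hcount, hlen, List.append_assoc, List.replicate_append_replicate, ← List.append_assoc,
        List.replicate_append_replicate] at h
      rwa [show q + p + (m + 1) = q + 1 + (p + m) by omega,
        show p + m + 2 * q + 1 + 1 = q + 1 + (p + m + (q + 1)) by omega]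
    · rw [fibMorphism_fibWord hab]
      rw [List.flatMap_singleton, List.flatMap_singleton]
      exact rotations_rotate_perm _ _

theorem r_fibWord (hab : a < b) {m : ℕ} (hm : 0 < m) : r (fibWord a b (2 * m + 1)) = 2 := by
  obtain ⟨p, q, h⟩ := exists_isTransform_fibWord hab m
  rw [r, h.bwt_eq, numRuns_append, numRuns_replicate _ (by omega), numRuns_replicate _ (by omega)]
  intro c hc d hd
  rw [List.eq_of_mem_replicate (List.mem_of_getLast? hc),
    List.eq_of_mem_replicate (List.mem_of_head? hd)]
  exact hab.ne'

/-! ### The Lyndon factors of Fibonacci words of odd index -/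

/-- The images of the letter `c` under the iterates of the morphism. Those of `b`, from the first
iterate on, are the Lyndon factors of the Fibonacci words of odd index, apart from the last factor
`a`. -/
def iterImage (a b c : α) (i : ℕ) : List α := (fibMorphism a b)^[i] [c]

theorem iterImage_zero (c : α) : iterImage a b c 0 = [c] := rfl

theorem iterImage_succ (c : α) (i : ℕ) :
    iterImage a b c (i + 1) = fibMorphism a b (iterImage a b c i) :=
  Function.iterate_succ_apply' _ _ _

theorem iterImage_a_succ (i : ℕ) :
    iterImage a b a (i + 1) = iterImage a b a i ++ (iterImage a b a i ++ iterImage a b b i) := by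
  induction i with
  | zero => simp [iterImage, fibMorphism]
  | succ i ih =>
    rw [iterImage_succ, ih, fibMorphism_append, fibMorphism_append, ← iterImage_succ,
      ← iterImage_succ, ih]

theorem exists_iterImage_a_eq (i : ℕ) : ∃ s, iterImage a b a i = [a] ++ s := by
  induction i with
  | zero => exact ⟨[], rfl⟩
  | succ i ih =>
    obtain ⟨s, hs⟩ := ih
    exact ⟨_, by rw [iterImage_a_succ, hs, List.append_assoc]⟩

theorem iterImage_b_succ (hab : a < b) (i : ℕ) :
    iterImage a b b (i + 1) = iterImage a b a i ++ iterImage a b b i := by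
  induction i with
  | zero => simp [iterImage, fibMorphism, hab.ne']
  | succ i ih => rw [iterImage_succ, ih, fibMorphism_append, ← iterImage_succ, ← iterImage_succ, ih]

theorem isOver_iterImage_b (i : ℕ) : IsOver a b (iterImage a b b i) := by
  cases i with
  | zero => simp [iterImage, IsOver]
  | succ i => rw [iterImage_succ]; exact isOver_fibMorphism _

theorem isLyndon_iterImage (hab : a < b) (i : ℕ) :
    IsLyndon (iterImage a b a i) ∧ IsLyndon (iterImage a b b i) ∧
      iterImage a b a i < iterImage a b b i := by
  induction i with
  | zero =>
    exact ⟨IsLyndon.singleton a, IsLyndon.singleton b, List.cons_lt_cons_iff.mpr (Or.inl hab)⟩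
  | succ i ih =>
    obtain ⟨hA, hB, hlt⟩ := ih
    have hAB := hA.append hB hlt
    rw [iterImage_a_succ, iterImage_b_succ hab]
    refine ⟨hA.append hAB ?_, hAB, ?_⟩
    · obtain ⟨c, s, hs⟩ := List.exists_cons_of_ne_nil hB.1
      have h := append_lt_append_left (iterImage a b a i) (List.nil_lt_cons c s)
      rwa [List.append_nil, ← hs] at h
    · exact append_lt_append_left _ (hAB.2 _ _ hA.1 hB.1 rfl)

theorem iterImage_b_antitone (hab : a < b) : Antitone (iterImage a b b) := by
  refine antitone_nat_of_succ_le fun i => ?_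
  obtain ⟨hA, hB, -⟩ := isLyndon_iterImage hab i
  have hAB := (isLyndon_iterImage hab (i + 1)).2.1
  rw [iterImage_b_succ hab] at hAB ⊢
  exact (hAB.2 _ _ hA.1 hB.1 rfl).le

theorem map_iterImage_range_succ (m : ℕ) :
    (List.range (m + 1)).map (iterImage a b b) =
      [b] :: ((List.range m).map (iterImage a b b)).map (fibMorphism a b) := by
  simp [List.range_succ_eq_map, iterImage_zero, Function.comp_def, iterImage_succ]

theorem flatten_iterImage (hab : a < b) (m : ℕ) :
    (((List.range m).map (iterImage a b b)).map (fibMorphism a b)).flatten ++ [a] =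
      fibWord a b (2 * m + 1) := by
  induction m with
  | zero => rfl
  | succ m ih =>
    -- After appending `ab`: `F_{2m+3} ab = ab θ(F_{2m+1})`, and `ab = θ(b)` is the first factor.
    refine List.append_cancel_right (bs := [a, b]) ?_
    have hflat : ∀ l : List (List α),
        (l.map (fibMorphism a b)).flatten = fibMorphism a b l.flatten := fun l => by
      induction l with
      | nil => rfl
      | cons x l ih => simp [ih, fibMorphism_append]
    rw [show 2 * (m + 1) + 1 = 2 * m + 1 + 2 by ring, fibWord_add_two_append hab, ← ih,
      map_iterImage_range_succ, fibMorphism_append, hflat, List.flatten_cons, fibMorphism_append]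
    simp [fibMorphism, hab.ne']

theorem isLyndonFactorization_fibWord (hab : a < b) (m : ℕ) :
    IsLyndonFactorization (((List.range m).map (iterImage a b b)).map (fibMorphism a b) ++ [[a]])
      (fibWord a b (2 * m + 1)) := by
  refine ⟨by rw [← flatten_iterImage hab]; simp, ?_, ?_⟩
  · intro f hf
    rcases List.mem_append.mp hf with hf | hf
    · simp only [List.mem_map] at hf
      obtain ⟨_, ⟨i, -, rfl⟩, rfl⟩ := hf
      rw [← iterImage_succ]
      exact (isLyndon_iterImage hab (i + 1)).2.1
    · rw [List.mem_singleton.mp hf]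
      exact IsLyndon.singleton a
  · refine List.pairwise_append.mpr ⟨?_, by simp, ?_⟩
    · rw [List.map_map, List.pairwise_map]
      refine List.pairwise_lt_range.imp fun {i j} hij => ?_
      simp only [Function.comp_apply, ← iterImage_succ]
      exact iterImage_b_antitone hab (by omega)
    · intro f hf g hg
      rw [List.mem_singleton.mp hg]
      simp only [List.mem_map] at hf
      obtain ⟨_, ⟨i, -, rfl⟩, rfl⟩ := hf
      rw [← iterImage_succ, iterImage_b_succ hab]
      obtain ⟨s, hs⟩ := exists_iterImage_a_eq (a := a) (b := b) i
      rw [hs, List.append_assoc]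
      exact le_append _ _

theorem lyndonFactorization_eq {fs : List (List α)} {w : List α}
    (h : IsLyndonFactorization fs w) : lyndonFactorization w = fs :=
  (existsUnique_isLyndonFactorization w).choose_spec.1.unique h

/-! ### The runs of the bijective transform -/

/-- Each further Lyndon factor adds two runs: applying the morphism appends a run of `a`, and the
new one-letter string `b` appends a run of `b`. -/
theorem exists_isTransform_iterImage (hab : a < b) (m : ℕ) :
    ∃ t, IsTransform ((List.range (m + 1)).map (iterImage a b b)) t ∧
      t.getLast? = some b ∧ 2 * m + 1 ≤ numRuns t := by
  induction m with
  | zero =>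
    refine ⟨[b], ⟨[[b]], by simp [iterImage, rotations], by simp, by simp [lastSymbols]⟩,
      by simp, ?_⟩
    exact (numRuns_replicate b one_pos).ge
  | succ m ih =>
    obtain ⟨t, ht, hlast, hruns⟩ := ih
    rw [map_iterImage_range_succ]
    refine ⟨_, (ht.map_fibMorphism hab ?_).cons_max ?_, by simp, ?_⟩
    · intro w hw
      obtain ⟨i, -, rfl⟩ := List.mem_map.mp hw
      exact isOver_iterImage_b i
    · intro w hw c hc
      obtain ⟨v, -, rfl⟩ := List.mem_map.mp hw
      rcases isOver_fibMorphism v c hc with rfl | rfl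
      · exact hab.le
      · exact le_rfl
    · have hlen : 0 < t.length := List.length_pos_iff.mpr (by rintro rfl; simp at hlast)
      rw [List.append_assoc, List.append_assoc]
      refine le_trans ?_ (numRuns_le_numRuns_append _ _)
      rw [numRuns_append, numRuns_append, numRuns_replicate _ hlen,
        show [b] = List.replicate 1 b from rfl, numRuns_replicate _ one_pos]
      · omega
      · intro c hc d hd
        simp [List.getLast?_replicate, hlen.ne'] at hc hd
        rw [← hc, ← hd]
        exact hab.ne
      · intro c hc d hd
        simp [List.head?_append, List.head?_replicate, hlen.ne', hlast] at hc hd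
        rw [← hc, ← hd]
        exact hab.ne'

theorem le_rB_fibWord (hab : a < b) (m : ℕ) :
    2 * (m + 1) ≤ rB (fibWord a b (2 * (m + 1) + 1)) := by
  obtain ⟨t, ht, hlast, hruns⟩ := exists_isTransform_iterImage hab m
  have hlen : 0 < t.length := List.length_pos_iff.mpr (by rintro rfl; simp at hlast)
  have h := (ht.map_fibMorphism hab fun w hw => by
    obtain ⟨i, -, rfl⟩ := List.mem_map.mp hw
    exact isOver_iterImage_b i).append_min (a := a) fun w hw c hc => by
      obtain ⟨v, -, rfl⟩ := List.mem_map.mp hw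
      rcases isOver_fibMorphism v c hc with rfl | rfl
      · exact le_rfl
      · exact hab.le
  rw [← lyndonFactorization_eq (isLyndonFactorization_fibWord hab (m + 1))] at h
  rw [rB, h.bbwt_eq]
  refine le_trans ?_ (numRuns_le_numRuns_cons _ _)
  refine le_trans ?_ (numRuns_le_numRuns_append _ _)
  rw [numRuns_append, numRuns_replicate _ hlen]
  · omega
  · intro c hc d hd
    simp [List.head?_replicate, hlen.ne', hlast] at hc hd
    rw [← hc, ← hd]
    exact hab.ne'

end Fibonacci

end BijectiveBWT

theorem mainTheorem3 :
    ∃ c : ℝ, 0 < c ∧ ∀ (α : Type*) [LinearOrder α] (a b : α), a < b →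
      Filter.Tendsto (fun k => (BijectiveBWT.fibWord a b k).length) Filter.atTop Filter.atTop ∧
      ∀ k : ℕ, Odd k → 3 ≤ k →
        BijectiveBWT.r (BijectiveBWT.fibWord a b k) = 2 ∧
        c * Real.log ((BijectiveBWT.fibWord a b k).length : ℝ) ≤
          (BijectiveBWT.rB (BijectiveBWT.fibWord a b k) : ℝ) := by
  refine ⟨1 / 2, by norm_num, fun α _ a b hab => ⟨?_, ?_⟩⟩
  · refine Filter.tendsto_atTop_mono (fun k => ?_) Filter.tendsto_id
    have h := Nat.le_fib_add_one (k + 1)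
    rw [BijectiveBWT.length_fibWord]
    simpa using h
  · rintro k ⟨m, rfl⟩ hk
    obtain ⟨m, rfl⟩ : ∃ n, m = n + 1 := ⟨m - 1, by omega⟩
    refine ⟨BijectiveBWT.r_fibWord hab m.succ_pos, ?_⟩
    have h1 : (2 * (m + 1) : ℝ) ≤
        (BijectiveBWT.rB (BijectiveBWT.fibWord a b (2 * (m + 1) + 1)) : ℝ) := by
      exact_mod_cast BijectiveBWT.le_rB_fibWord hab m
    have h2 : ((BijectiveBWT.fibWord a b (2 * (m + 1) + 1)).length : ℝ) ≤
        2 ^ (2 * (m + 1) + 1) := by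
      exact_mod_cast BijectiveBWT.length_fibWord_le (a := a) (b := b) (2 * (m + 1) + 1)
    have h3 : (0 : ℝ) < ((BijectiveBWT.fibWord a b (2 * (m + 1) + 1)).length : ℝ) := by
      rw [BijectiveBWT.length_fibWord]
      exact_mod_cast Nat.fib_pos.mpr (Nat.succ_pos _)
    have h4 := Real.log_le_log h3 h2
    rw [Real.log_pow] at h4
    have h5 : Real.log 2 ≤ 1 := by linarith [Real.log_two_lt_d9]
    push_cast at h4
    -- With `log 2 ≤ 1`, the length bound gives `log |F_{2m+3}| ≤ 2m + 3 ≤ 2 (2m + 2)`.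
    nlinarith
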